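/- **Conventions.** Let $n\ge 0$ be an integer. $\dim$ is the (Lebesgue) covering dimension. An inclusion $A\hookrightarrow B$ of spaces is *trivial in $\pi_i$* if every continuous map $S^i\to A$ is nullhomotopic as a map to $B$. A space $X$ is *$LC^n$* (locally $n$-connected) if for every $x\in X$ and every open neighborhood $\mathcal U$ of $x$ there is an open neighborhood $\mathcal V\subseteq\mathcal U$ of $x$ such that $\mathcal V\hookrightarrow\mathcal U$ is trivial in $\pi_i$ for all $0\le i\le n$. A nowhere dense closed subset $Z\subseteq X$ is *$LCC^n$* in $X$ (locally complementarily $n$-connected) if for every $z\in Z$ and every open neighborhood $\mathcal U$ of $z$ in $X$ there is an open neighborhood $\mathcal V\subseteq\mathcal U$ of $z$ in $X$ such that $\mathcal V\setminus Z\hookrightarrow\mathcal U\setminus Z$ is trivial in $\pi_i$ for all $0\le i\le n$. A nowhere dense closed subset $Z\subseteq X$ is a *Z-set* in $X$ if there is a continuous map $H:X\times[0,1]\to X$ with $H(x,0)=x$ for all $x\in X$ and $H(X\times(0,1])\subseteq X\setminus Z$. A compact metrizable space $X$ is an *AR* (resp. *ANR*) if, whenever $X$ is embedded as a closed subset of a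 compact metrizable space $Y$, it is a retract of $Y$ (resp. of some open neighborhood of $X$ in $Y$). **Theorem.** Let $X$ be a compact metrizable space with $\dim X\le n$, and let $Z\subset X$ be a nowhere dense closed subset which is $LCC^n$ in $X$ and such that $X\setminus Z$ is $LC^n$. Then $X$ is an ANR and $Z$ is a Z-set in $X$. If in addition $X\setminus Z$ is contractible, then $X$ is an AR. -/

import Mathlib

open Set Topology TopologicalSpace

/-- The Lebesgue covering dimension of `X` is at most `n`: every finite open cover of `X` has a
finite open refinement covering `X`, no point of `X` lying in more than `n + 1` of its members. -/
def CoveringDimLE (n : ℕ) (X : Type*) [TopologicalSpace X] : Prop :=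
  ∀ U : Set (Set X), U.Finite → (∀ u ∈ U, IsOpen u) → ⋃₀ U = univ →
    ∃ V : Set (Set X), V.Finite ∧ (∀ v ∈ V, IsOpen v) ∧ ⋃₀ V = univ ∧
      (∀ v ∈ V, ∃ u ∈ U, v ⊆ u) ∧ ∀ x : X, {v ∈ V | x ∈ v}.encard ≤ (n : ℕ∞) + 1

/-- The inclusion of `A` in `B` is trivial in `π_i` for all `0 ≤ i ≤ n`: every continuous map from
the sphere `S^i` to `A` is nullhomotopic as a map to `B`. -/
def InclusionTrivialPi {X : Type*} [TopologicalSpace X] (n : ℕ) {A B : Set X} (h : A ⊆ B) : Prop :=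
  ∀ i : ℕ, i ≤ n → ∀ f : C(Metric.sphere (0 : EuclideanSpace ℝ (Fin (i + 1))) 1, A),
    ((ContinuousMap.inclusion h).comp f).Nullhomotopic

/-- `X` is locally `n`-connected (`LC^n`). -/
def IsLC (n : ℕ) (X : Type*) [TopologicalSpace X] : Prop :=
  ∀ x : X, ∀ U : Set X, IsOpen U → x ∈ U →
    ∃ V : Set X, IsOpen V ∧ x ∈ V ∧ ∃ h : V ⊆ U, InclusionTrivialPi n h

/-- `Z` is locally complementarily `n`-connected (`LCC^n`) in `X`. -/
def IsLCC {X : Type*} [TopologicalSpace X] (n : ℕ) (Z : Set X) : Prop :=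
  ∀ z ∈ Z, ∀ U : Set X, IsOpen U → z ∈ U →
    ∃ V : Set X, IsOpen V ∧ z ∈ V ∧ ∃ h : V ⊆ U,
      InclusionTrivialPi n (sdiff_subset_sdiff_left h : V \ Z ⊆ U \ Z)

/-- `Z` is a Z-set in `X`: it is closed and nowhere dense, and `X` can be instantaneously homotoped
off `Z`. -/
def IsZSet {X : Type*} [TopologicalSpace X] (Z : Set X) : Prop :=
  IsClosed Z ∧ IsNowhereDense Z ∧
    ∃ H : C(X × unitInterval, X), (∀ x : X, H (x, 0) = x) ∧
      ∀ (x : X) (t : unitInterval), 0 < t → H (x, t) ∉ Z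

universe u

/-- A (compact metrizable) space `X` is an absolute neighborhood retract: whenever `X` is embedded
as a closed subset of a compact metrizable space `Y`, some open neighborhood of it in `Y`
retracts onto it. -/
def IsANR (X : Type u) [TopologicalSpace X] : Prop :=
  ∀ (Y : Type u) [TopologicalSpace Y] [CompactSpace Y] [MetrizableSpace Y] (e : X → Y),
    IsClosedEmbedding e →
      ∃ O : Set Y, IsOpen O ∧ range e ⊆ O ∧
        ∃ r : C(O, X), ∀ (x : X) (hx : e x ∈ O), r ⟨e x, hx⟩ = x

/-- A (compact metrizable) space `X` is an absolute retract: whenever `X` is embedded as a closed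
subset of a compact metrizable space `Y`, the space `Y` retracts onto it. -/
def IsAR (X : Type u) [TopologicalSpace X] : Prop :=
  ∀ (Y : Type u) [TopologicalSpace Y] [CompactSpace Y] [MetrizableSpace Y] (e : X → Y),
    IsClosedEmbedding e → ∃ r : C(Y, X), ∀ x : X, r (e x) = x

/-!
Put `W = X \ Z`. The two local connectivity hypotheses and compactness say that small spheres of
dimension at most `n` in `W` bound small balls in `W`, also near points of `Z`. Choose finite open
covers of `X` of order at most `n + 1`, each refining the previous one, with mesh tending to zero.
The telescope formed by their nerves and the mapping cylinders between consecutive nerves has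
dimension at most `n + 1`, so it can be mapped into `W` skeleton by skeleton, simplices of level `k`
becoming small as `k` grows.

Let `X` be embedded in `Y`, and let `ν : Y → X` be a nearest point selection, continuous at the
points of `X`. On thin annuli around `X`, partitions of unity subordinate to the pulled back covers
map `Y` to the nerves; crossing an annulus, one slides along a mapping cylinder from one nerve to
the next. Composing with the realization of the telescope and extending by the identity on `X`
gives a retraction of a neighborhood of `X` onto `X` which maps the complement of `X` into `W`.
For `Y = X × [0, 1]` and `X × {0}` this retraction is a homotopy of `X` off `Z`. If `W` is
contractible, the homotopy makes the identity of `X` nullhomotopic, and then a neighborhood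
retraction extends to the whole of `Y`.
-/

open Metric Filter

section SphereFilling

theorem exists_extension_of_nullhomotopic {E Y : Type*} [NormedAddCommGroup E] [NormedSpace ℝ E]
    [TopologicalSpace Y] {f : C(sphere (0 : E) 1, Y)} (hf : f.Nullhomotopic) :
    ∃ F : C(E, Y), ∀ v : sphere (0 : E) 1, F v = f v := by
  classical
  obtain ⟨c, ⟨H⟩⟩ := hf
  let F : E → Y := fun v => if hv : v ∈ ({0}ᶜ : Set E) then
    H (projIcc 0 1 zero_le_one (2 - 2 * ‖v‖), (homeomorphUnitSphereProd E ⟨v, hv⟩).1) else c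
  have hF_compl : ContinuousOn F {0}ᶜ := by
    rw [continuousOn_iff_continuous_domRestrict]
    have : Continuous fun v : ({0}ᶜ : Set E) =>
        H (projIcc 0 1 zero_le_one (2 - 2 * ‖(v : E)‖), (homeomorphUnitSphereProd E v).1) :=
      H.continuous.comp ((continuous_projIcc.comp (by fun_prop)).prodMk
        (continuous_fst.comp (homeomorphUnitSphereProd E).continuous))
    exact this.congr fun v => by simp only [domRestrict_apply, F, dif_pos v.2]
  have hF_zero : F =ᶠ[𝓝 0] fun _ => c := by
    filter_upwards [ball_mem_nhds (0 : E) one_half_pos] with v hv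
    rw [mem_ball_zero_iff] at hv
    have hproj : projIcc (0 : ℝ) 1 zero_le_one (2 - 2 * ‖v‖) = 1 :=
      projIcc_of_right_le _ (by linarith)
    simp only [F, hproj, H.apply_one, ContinuousMap.const_apply, dite_eq_ite, ite_self]
  refine ⟨⟨F, continuous_iff_continuousAt.2 fun v => ?_⟩, fun v => ?_⟩
  · rcases eq_or_ne v 0 with rfl | hv
    · exact continuousAt_const.congr hF_zero.symm
    · exact hF_compl.continuousAt (isOpen_compl_singleton.mem_nhds hv)
  · have hv : ‖(v : E)‖ = 1 := norm_eq_of_mem_sphere v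
    have hv0 : (v : E) ∈ ({0}ᶜ : Set E) := ne_zero_of_mem_unit_sphere v
    have hsphere : (homeomorphUnitSphereProd E ⟨v, hv0⟩).1 = v := by
      ext
      simp [hv]
    have hproj : projIcc (0 : ℝ) 1 zero_le_one (2 - 2 * ‖(v : E)‖) = 0 :=
      projIcc_of_le_left _ (by linarith)
    simp only [ContinuousMap.coe_mk, F, dif_pos hv0, hsphere, hproj, H.apply_zero]

/-- Every map of the `m`-sphere into `A` extends to a map of the ambient Euclidean space (hence of
the ball) into `B`. Both maps are total functions on `EuclideanSpace ℝ (Fin (m + 1))`. -/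
def SpheresFill {X : Type*} [TopologicalSpace X] (m : ℕ) (A B : Set X) : Prop :=
  ∀ f : EuclideanSpace ℝ (Fin (m + 1)) → X, ContinuousOn f (sphere 0 1) →
    MapsTo f (sphere 0 1) A → ∃ F : EuclideanSpace ℝ (Fin (m + 1)) → X,
      Continuous F ∧ (∀ v, F v ∈ B) ∧ EqOn F f (sphere 0 1)

namespace SpheresFill

variable {X : Type*} [TopologicalSpace X] {m : ℕ} {A A' B B' : Set X}

theorem mono (h : SpheresFill m A B) (hA : A' ⊆ A) (hB : B ⊆ B') : SpheresFill m A' B' :=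
  fun f hf hfA =>
    let ⟨F, hF, hFB, hFf⟩ := h f hf (hfA.mono_right hA)
    ⟨F, hF, fun v => hB (hFB v), hFf⟩

theorem subset (h : SpheresFill m A B) : A ⊆ B := fun a ha =>
  let ⟨F, _, hFB, hFf⟩ := h (fun _ => a) continuousOn_const fun _ _ => ha
  let ⟨v, hv⟩ := NormedSpace.sphere_nonempty (x := (0 : EuclideanSpace ℝ (Fin (m + 1)))).2
    zero_le_one
  (show F v = a from hFf hv) ▸ hFB v

theorem of_empty_left : SpheresFill m ∅ B := fun _ _ hf =>
  let ⟨_, hv⟩ := NormedSpace.sphere_nonempty (x := (0 : EuclideanSpace ℝ (Fin (m + 1)))).2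
    zero_le_one
  (hf hv).elim

end SpheresFill

theorem InclusionTrivialPi.spheresFill {X Y : Type*} [TopologicalSpace X] [TopologicalSpace Y]
    {n : ℕ} {A B : Set Y} {h : A ⊆ B} (hAB : InclusionTrivialPi n h) {j : Y → X}
    (hj : IsInducing j) {i : ℕ} (hi : i ≤ n) : SpheresFill i (j '' A) (j '' B) := by
  intro f hf hfA
  obtain ⟨v₀, hv₀⟩ := NormedSpace.sphere_nonempty
    (x := (0 : EuclideanSpace ℝ (Fin (i + 1)))).2 zero_le_one
  have : Nonempty Y := ⟨(hfA hv₀).choose⟩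
  choose! g hgA hjg using fun v (hv : v ∈ sphere (0 : EuclideanSpace ℝ (Fin (i + 1))) 1) => hfA hv
  have hg : ContinuousOn g (sphere 0 1) := by
    rw [hj.continuousOn_iff]
    exact hf.congr hjg
  obtain ⟨F, hF⟩ := exists_extension_of_nullhomotopic
    (hAB i hi ⟨fun v => ⟨g v, hgA v v.2⟩,
      (continuousOn_iff_continuous_domRestrict.1 hg).subtype_mk _⟩)
  refine ⟨fun v => j (F v), by have := hj.continuous; fun_prop, fun v => ⟨F v, (F v).2, rfl⟩,
    fun v hv => (congrArg (fun b : B => j b) (hF ⟨v, hv⟩)).trans (hjg v hv)⟩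

end SphereFilling

section Simplices

variable {ι : Type*} {σ τ : Finset ι} {x : ι → ℝ}

/-- The face spanned by `σ` of the full simplex on the vertex set `ι`, in barycentric
coordinates. -/
def simplexFace (σ : Finset ι) : Set (ι → ℝ) :=
  {x | (∀ i, 0 ≤ x i) ∧ (∀ i ∉ σ, x i = 0) ∧ ∑ i ∈ σ, x i = 1}

/-- The relative boundary of the simplex `simplexFace σ`. -/
def simplexFaceBoundary (σ : Finset ι) : Set (ι → ℝ) :=
  {x | x ∈ simplexFace σ ∧ ∃ i ∈ σ, x i = 0}

theorem isClosed_simplexFace (σ : Finset ι) : IsClosed (simplexFace σ) := by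
  simp only [simplexFace, ofPred_and, ofPred_forall]
  refine .inter (isClosed_iInter fun i => isClosed_le continuous_const (continuous_apply i)) <|
    .inter (isClosed_biInter fun i _ => isClosed_eq (continuous_apply i) continuous_const) <|
    isClosed_eq (by fun_prop) continuous_const

theorem convex_simplexFace (σ : Finset ι) : Convex ℝ (simplexFace σ) := by
  rintro x ⟨hx, hxσ, hx1⟩ y ⟨hy, hyσ, hy1⟩ a b ha hb hab
  refine ⟨fun i => ?_, fun i hi => by simp [hxσ i hi, hyσ i hi], ?_⟩
  · exact add_nonneg (mul_nonneg ha (hx i)) (mul_nonneg hb (hy i))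
  · simp [Finset.sum_add_distrib, ← Finset.mul_sum, hx1, hy1, hab]

theorem simplexFace_mono (h : σ ⊆ τ) : simplexFace σ ⊆ simplexFace τ := fun _ hx =>
  ⟨hx.1, fun i hi => hx.2.1 i fun hiσ => hi (h hiσ),
    (Finset.sum_subset h fun i _ hi => hx.2.1 i hi) ▸ hx.2.2⟩

theorem nonempty_of_mem_simplexFace (hx : x ∈ simplexFace σ) : σ.Nonempty :=
  Finset.nonempty_of_sum_ne_zero (hx.2.2.trans_ne one_ne_zero)

theorem subset_of_mem_simplexFace (hx : x ∈ simplexFace τ) (hσ : ∀ i ∈ σ, x i ≠ 0) : σ ⊆ τ :=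
  fun i hi => by_contra fun h => hσ i hi (hx.2.1 i h)

theorem mem_simplexFace_erase [DecidableEq ι] (hx : x ∈ simplexFace σ) {i : ι} (hi : x i = 0) :
    x ∈ simplexFace (σ.erase i) := by
  refine ⟨hx.1, fun j hj => ?_, by rw [Finset.sum_erase _ hi, hx.2.2]⟩
  rcases eq_or_ne j i with rfl | hji
  · exact hi
  · exact hx.2.1 j fun hjσ => hj (Finset.mem_erase.2 ⟨hji, hjσ⟩)

theorem exists_erase_of_mem_simplexFaceBoundary [DecidableEq ι] (hx : x ∈ simplexFaceBoundary σ) :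
    ∃ i ∈ σ, x ∈ simplexFace (σ.erase i) :=
  let ⟨hxσ, i, hi, hxi⟩ := hx
  ⟨i, hi, mem_simplexFace_erase hxσ hxi⟩

theorem continuousOn_of_forall_exists_simplexFace {X : Type*} [TopologicalSpace X]
    {F : (ι → ℝ) → X} {P : Set (ι → ℝ)} (V : Finset ι)
    (h : ∀ x ∈ P, ∃ σ ⊆ V, x ∈ simplexFace σ ∧ ContinuousOn F (simplexFace σ)) :
    ContinuousOn F P := by
  let S : Set (Finset ι) := {σ | σ ⊆ V ∧ ContinuousOn F (simplexFace σ)}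
  have hS : S.Finite := V.powerset.finite_toSet.subset fun σ hσ => by simpa using hσ.1
  have := hS.to_subtype
  refine (LocallyFinite.continuousOn_iUnion (f := fun σ : S => simplexFace σ.1)
    (locallyFinite_of_finite _) (fun σ => isClosed_simplexFace σ.1) fun σ => σ.2.2).mono ?_
  intro x hx
  obtain ⟨σ, hσV, hxσ, hσ⟩ := h x hx
  exact mem_iUnion.2 ⟨⟨σ, hσV, hσ⟩, hxσ⟩

end Simplices

section Extension

theorem frontier_convexHull_range_affineBasis {κ E : Type*} [Finite κ] [NormedAddCommGroup E]
    [NormedSpace ℝ E] (b : AffineBasis κ ℝ E) :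
    frontier (convexHull ℝ (range b)) =
      {x | (∀ i, 0 ≤ b.coord i x) ∧ ∃ i, b.coord i x = 0} := by
  rw [((finite_range b).isClosed_convexHull (𝕜 := ℝ)).frontier_eq, b.interior_convexHull,
    b.convexHull_eq_nonneg_coord]
  ext x
  simp only [Set.mem_sdiff, mem_ofPred_eq, not_forall, not_lt]
  exact and_congr_right fun h => exists_congr fun i => ⟨fun hi => hi.antisymm (h i), Eq.le⟩

theorem exists_simplexFaceBoundary_chart {ι E : Type*} [NormedAddCommGroup E] [NormedSpace ℝ E]
    [FiniteDimensional ℝ E] {σ : Finset ι} (hσ : σ.card = Module.finrank ℝ E + 1) :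
    ∃ (φ : (ι → ℝ) → E) (ψ : E → ι → ℝ), Continuous φ ∧ Continuous ψ ∧
      MapsTo φ (simplexFaceBoundary σ) (sphere 0 1) ∧
      MapsTo ψ (sphere 0 1) (simplexFaceBoundary σ) ∧ LeftInvOn ψ φ (simplexFaceBoundary σ) := by
  classical
  obtain ⟨b⟩ := AffineBasis.exists_affineBasis_of_finiteDimensional (k := ℝ) (P := E) (ι := σ)
    (by simpa using hσ)
  obtain ⟨h, -, -, hfr⟩ := exists_homeomorph_image_interior_closure_frontier_eq_unitBall
    (convex_convexHull ℝ (range b)) ⟨_, b.centroid_mem_interior_convexHull⟩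
    (isBounded_convexHull.2 (finite_range b).isBounded)
  rw [frontier_convexHull_range_affineBasis] at hfr
  let comb : (ι → ℝ) → E := fun x => ∑ i : σ, x i • b i
  have hcoord : ∀ x ∈ simplexFace σ, ∀ i : σ, b.coord i (comb x) = x i := fun x hx i => by
    have hsum : ∑ i : σ, x i = 1 := by rw [Finset.sum_coe_sort, hx.2.2]
    rw [← b.coord_apply_combination_of_mem (Finset.mem_univ i) hsum,
      Finset.univ.affineCombination_eq_linear_combination _ _ hsum]
  refine ⟨fun x => h (comb x),
    fun v i => if hi : i ∈ σ then b.coord ⟨i, hi⟩ (h.symm v) else 0, by fun_prop,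
    continuous_pi fun i => ?_, fun x hx => ?_, fun v hv => ?_, fun x hx => funext fun i => ?_⟩
  · split_ifs with hi
    · exact (continuous_barycentric_coord b _).comp h.symm.continuous
    · exact continuous_const
  · obtain ⟨hx, i, hi, hxi⟩ := hx
    exact hfr ▸ mem_image_of_mem h
      ⟨fun j => hcoord x hx j ▸ hx.1 j, ⟨i, hi⟩, by rw [hcoord x hx, hxi]⟩
  · rw [← hfr] at hv
    obtain ⟨y, ⟨hy, i, hyi⟩, rfl⟩ := hv
    simp only [h.symm_apply_apply]
    refine ⟨⟨fun j => ?_, fun j hj => dif_neg hj, ?_⟩, i, i.2, by simp [hyi]⟩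
    · dsimp only
      split_ifs with hj
      exacts [hy _, le_rfl]
    · rw [← Finset.sum_coe_sort, ← b.sum_coord_apply_eq_one y]
      simp
  · by_cases hi : i ∈ σ
    · simp [hi, hcoord x hx.1]
    · simp [hi, hx.1.2.1 i hi]

theorem SpheresFill.exists_extension {ι X : Type*} [TopologicalSpace X] {m : ℕ} {A B : Set X}
    (h : SpheresFill m A B) {σ : Finset ι} (hσ : σ.card = m + 2) {g : (ι → ℝ) → X}
    (hg : ContinuousOn g (simplexFaceBoundary σ)) (hgA : MapsTo g (simplexFaceBoundary σ) A) :
    ∃ G : (ι → ℝ) → X, Continuous G ∧ (∀ x, G x ∈ B) ∧ EqOn G g (simplexFaceBoundary σ) := by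
  obtain ⟨φ, ψ, hφ, hψ, hφs, hψs, hψφ⟩ := exists_simplexFaceBoundary_chart
    (E := EuclideanSpace ℝ (Fin (m + 1))) (σ := σ) (by simpa using hσ)
  obtain ⟨F, hF, hFB, hFg⟩ := h (g ∘ ψ) (hg.comp hψ.continuousOn hψs) (hgA.comp hψs)
  exact ⟨F ∘ φ, hF.comp hφ, fun x => hFB (φ x), fun x hx =>
    (hFg (hφs hx)).trans (congrArg g (hψφ hx))⟩

end Extension

section Carriers

variable {ι X : Type*}

theorem exists_glue_simplexFaces {c : ℕ} {S : Set (Finset ι)} (hS : ∀ σ ∈ S, σ.card = c)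
    {F : (ι → ℝ) → X} {G : Finset ι → (ι → ℝ) → X}
    (hG : ∀ σ ∈ S, EqOn (G σ) F (simplexFaceBoundary σ)) :
    ∃ F' : (ι → ℝ) → X, (∀ σ ∈ S, EqOn F' (G σ) (simplexFace σ)) ∧
      ∀ τ, τ.card < c → EqOn F' F (simplexFace τ) := by
  classical
  let F' : (ι → ℝ) → X := fun x =>
    if h : ∃ σ ∈ S, x ∈ simplexFace σ \ simplexFaceBoundary σ then G h.choose x else F x
  have subset_of_open {x : ι → ℝ} {σ τ : Finset ι} (hτ : x ∈ simplexFace τ)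
      (hσ : x ∈ simplexFace σ \ simplexFaceBoundary σ) : σ ⊆ τ :=
    subset_of_mem_simplexFace hτ fun i hi hxi => hσ.2 ⟨hσ.1, i, hi, hxi⟩
  refine ⟨F', fun σ hσ x hx => ?_, fun τ hτ x hx => dif_neg ?_⟩
  · by_cases h : ∃ σ ∈ S, x ∈ simplexFace σ \ simplexFaceBoundary σ
    · obtain ⟨hσ', hx'⟩ := h.choose_spec
      have hσσ' : h.choose = σ := Finset.eq_of_subset_of_card_le (subset_of_open hx hx')
        ((hS σ hσ).trans (hS _ hσ').symm).le
      simp only [F', dif_pos h, hσσ']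
    · have hxσ : x ∈ simplexFaceBoundary σ := by_contra fun hxσ => h ⟨σ, hσ, hx, hxσ⟩
      simp only [F', dif_neg h, hG σ hσ hxσ]
  · rintro ⟨σ, hσ, hxσ⟩
    have := Finset.card_le_card (subset_of_open hx hxσ)
    rw [hS σ hσ] at this
    omega

variable [TopologicalSpace X]

/-- `F` maps every simplex of dimension at most `d` of the complex `L` continuously into the set
that the carrier `Φ` assigns to it. -/
def IsCarriedOn (L : Set (Finset ι)) (Φ : Finset ι → Set X) (d : ℕ) (F : (ι → ℝ) → X) : Prop :=
  ∀ σ ∈ L, σ.card ≤ d + 1 → ContinuousOn F (simplexFace σ) ∧ MapsTo F (simplexFace σ) (Φ σ)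

theorem exists_isCarriedOn_zero [Nonempty X] {L : Set (Finset ι)} {Φ : Finset ι → Set X}
    (hΦ : ∀ i, {i} ∈ L → (Φ {i}).Nonempty) : ∃ F, IsCarriedOn L Φ 0 F := by
  classical
  choose! w hw using hΦ
  let x₀ : X := Classical.arbitrary X
  let G : Finset ι → (ι → ℝ) → X := fun σ _ => if h : σ.Nonempty then w h.choose else x₀
  have hG (i : ι) (x : ι → ℝ) : G {i} x = w i := by
    have h : ({i} : Finset ι).Nonempty := Finset.singleton_nonempty i
    simp only [G, dif_pos h, Finset.mem_singleton.1 h.choose_spec]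
  obtain ⟨F, hF, -⟩ := exists_glue_simplexFaces (c := 1) (S := {σ | σ.card = 1})
    (F := fun _ => x₀) (G := G) (fun _ hσ => hσ) fun σ hσ x hx => by
      obtain ⟨i, hi, hx⟩ := exists_erase_of_mem_simplexFaceBoundary hx
      have := (nonempty_of_mem_simplexFace hx).card_pos
      rw [Finset.card_erase_of_mem hi, hσ] at this
      omega
  refine ⟨F, fun σ hσL hσ => ?_⟩
  rcases σ.eq_empty_or_nonempty with rfl | hne
  · have hempty : simplexFace (∅ : Finset ι) = ∅ := eq_empty_of_forall_notMem fun x hx =>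
      Finset.not_nonempty_empty (nonempty_of_mem_simplexFace hx)
    exact hempty ▸ ⟨continuousOn_empty F, mapsTo_empty F _⟩
  · have hσ1 : σ.card = 1 := hσ.antisymm hne.card_pos
    have hFσ := hF σ hσ1
    obtain ⟨i, rfl⟩ := Finset.card_eq_one.1 hσ1
    exact ⟨(continuousOn_const (c := w i)).congr fun x hx => (hFσ hx).trans (hG i x),
      fun x hx => ((hFσ hx).trans (hG i x)) ▸ hw i hσL⟩

theorem IsCarriedOn.exists_succ [Nonempty X] {L : Set (Finset ι)} (hL : IsLowerSet L)
    {Φ Φ' : Finset ι → Set X} (hΦ : Monotone Φ) {d : ℕ}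
    (hfill : ∀ σ ∈ L, SpheresFill d (Φ σ) (Φ' σ)) {F : (ι → ℝ) → X}
    (hF : IsCarriedOn L Φ d F) : ∃ F', IsCarriedOn L Φ' (d + 1) F' := by
  classical
  have hF_boundary : ∀ σ ∈ L, σ.card = d + 2 → ContinuousOn F (simplexFaceBoundary σ) ∧
      MapsTo F (simplexFaceBoundary σ) (Φ σ) := by
    intro σ hσL hσ
    have hface (i : ι) (hi : i ∈ σ) := hF (σ.erase i) (hL (σ.erase_subset i) hσL)
      (by rw [Finset.card_erase_of_mem hi]; omega)
    refine ⟨continuousOn_of_forall_exists_simplexFace σ fun x hx => ?_, fun x hx => ?_⟩ <;>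
      obtain ⟨i, hi, hxi⟩ := exists_erase_of_mem_simplexFaceBoundary hx
    · exact ⟨_, σ.erase_subset i, hxi, (hface i hi).1⟩
    · exact hΦ (σ.erase_subset i) ((hface i hi).2 hxi)
  have hG (σ : Finset ι) (hσ : σ ∈ L ∧ σ.card = d + 2) :=
    (hfill σ hσ.1).exists_extension hσ.2 (hF_boundary σ hσ.1 hσ.2).1 (hF_boundary σ hσ.1 hσ.2).2
  choose! G hG_cont hG_mem hG_eq using hG
  obtain ⟨F', hF'G, hF'F⟩ := exists_glue_simplexFaces (S := {σ | σ ∈ L ∧ σ.card = d + 2})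
    (fun _ hσ => hσ.2) hG_eq
  refine ⟨F', fun σ hσL hσ => ?_⟩
  rcases hσ.eq_or_lt with hσ | hσ
  · exact ⟨(hG_cont σ ⟨hσL, hσ⟩).continuousOn.congr (hF'G σ ⟨hσL, hσ⟩),
      fun x hx => hF'G σ ⟨hσL, hσ⟩ hx ▸ hG_mem σ ⟨hσL, hσ⟩ x⟩
  · obtain ⟨hFσ, hFΦ⟩ := hF σ hσL (Nat.lt_succ_iff.1 hσ)
    exact ⟨hFσ.congr (hF'F σ hσ), fun x hx => hF'F σ hσ hx ▸ (hfill σ hσL).subset (hFΦ hx)⟩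

theorem exists_isCarriedOn [Nonempty X] {L : Set (Finset ι)} (hL : IsLowerSet L)
    {Φ : ℕ → Finset ι → Set X} (hmono : ∀ j, Monotone (Φ j))
    (hne : ∀ i, {i} ∈ L → (Φ 0 {i}).Nonempty) (d : ℕ)
    (hfill : ∀ j < d, ∀ σ ∈ L, SpheresFill j (Φ j σ) (Φ (j + 1) σ)) :
    ∃ F, IsCarriedOn L (Φ d) d F := by
  induction d with
  | zero => exact exists_isCarriedOn_zero hne
  | succ d ih =>
    obtain ⟨F, hF⟩ := ih fun j hj => hfill j (hj.trans d.lt_succ_self)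
    exact hF.exists_succ hL (hmono d) (hfill d d.lt_succ_self)

end Carriers

section UniformLocalConnectivity

theorem exists_seq_pos_halving {P : ℕ → ℝ → ℝ → Prop}
    (h : ∀ k, ∀ a > 0, ∀ᶠ b in 𝓝[>] 0, P k a b) :
    ∃ e : ℕ → ℝ, (∀ k, 0 < e k) ∧ (∀ k, e (k + 1) ≤ e k / 2) ∧
      Tendsto e atTop (𝓝 0) ∧ ∀ k, P k (e k) (e (k + 1)) := by
  have hnext : ∀ k, ∀ a > 0, ∃ b > 0, b ≤ a / 2 ∧ P k a b := fun k a ha =>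
    let ⟨b, hP, hb⟩ := ((h k a ha).and (Ioc_mem_nhdsGT (half_pos ha))).exists
    ⟨b, hb.1, hb.2, hP⟩
  choose! b hb_pos hb_le hbP using hnext
  let e : ℕ → ℝ := fun k => Nat.rec 1 b k
  have he_pos : ∀ k, 0 < e k := fun k => by
    induction k with
    | zero => exact one_pos
    | succ k ih => exact hb_pos k _ ih
  have he_half : ∀ k, e (k + 1) ≤ e k / 2 := fun k => hb_le k _ (he_pos k)
  have he_pow : ∀ k, e k ≤ (1 / 2) ^ k := fun k => by
    induction k with
    | zero => exact (pow_zero _).ge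
    | succ k ih => rw [pow_succ]; linarith [he_half k]
  exact ⟨e, he_pos, he_half, squeeze_zero (fun k => (he_pos k).le) he_pow
    (tendsto_pow_atTop_nhds_zero_of_lt_one one_half_pos.le one_half_lt_one),
    fun k => hbP k _ (he_pos k)⟩

theorem exists_spheresFill_compl {X : Type*} [TopologicalSpace X] {n : ℕ} {Z : Set X}
    (hZc : IsClosed Z) (hLCC : IsLCC n Z) (hLC : IsLC n (Zᶜ : Set X)) (x : X) {U : Set X}
    (hU : IsOpen U) (hx : x ∈ U) :
    ∃ V : Set X, IsOpen V ∧ x ∈ V ∧ ∀ i ≤ n, SpheresFill i (V ∩ Zᶜ) (U ∩ Zᶜ) := by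
  by_cases hxZ : x ∈ Z
  · obtain ⟨V, hV, hxV, h, hVU⟩ := hLCC x hxZ U hU hx
    refine ⟨V, hV, hxV, fun i hi => ?_⟩
    simpa only [image_id, sdiff_eq] using hVU.spheresFill IsInducing.id hi
  · obtain ⟨V, hV, hxV, h, hVU⟩ := hLC ⟨x, hxZ⟩ (Subtype.val ⁻¹' U)
      (hU.preimage continuous_subtype_val) hx
    refine ⟨Subtype.val '' V, hZc.isOpen_compl.isOpenMap_subtype_val V hV, ⟨_, hxV, rfl⟩,
      fun i hi => (hVU.spheresFill IsInducing.subtypeVal hi).mono inter_subset_left ?_⟩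
    rw [Subtype.image_preimage_coe, inter_comm]

/-- The part `W` of `X` is uniformly locally `n`-connected, at the points of its closure as well as
at its own points: small spheres of dimension at most `n` in `W` bound small balls in `W`. -/
def UniformlyLC {X : Type*} [PseudoMetricSpace X] (n : ℕ) (W : Set X) : Prop :=
  ∀ ε > 0, ∃ δ > 0, ∀ x : X, ∀ i ≤ n, SpheresFill i (ball x δ ∩ W) (ball x ε ∩ W)

theorem uniformlyLC_compl {X : Type*} [PseudoMetricSpace X] [CompactSpace X] {n : ℕ} {Z : Set X}
    (hZc : IsClosed Z) (hLCC : IsLCC n Z) (hLC : IsLC n (Zᶜ : Set X)) : UniformlyLC n Zᶜ := by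
  intro ε hε
  choose V hV hxV hfill using fun x : X =>
    exists_spheresFill_compl hZc hLCC hLC x (isOpen_ball (ε := ε / 2))
      (mem_ball_self (half_pos hε))
  obtain ⟨δ, hδ, hLebesgue⟩ := lebesgue_number_lemma_of_metric (isCompact_univ (X := X))
    (c := fun x => V x ∩ ball x (ε / 2)) (fun x => (hV x).inter isOpen_ball)
    fun x _ => mem_iUnion.2 ⟨x, hxV x, mem_ball_self (half_pos hε)⟩
  refine ⟨δ, hδ, fun x i hi => ?_⟩
  obtain ⟨z, hz⟩ := hLebesgue x (mem_univ x)
  have hxz : dist z x < ε / 2 := mem_ball'.1 (hz (mem_ball_self hδ)).2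
  exact (hfill z i hi).mono (inter_subset_inter_left _ fun y hy => (hz hy).1)
    (inter_subset_inter_left _ (ball_subset_ball' (by linarith)))

theorem UniformlyLC.exists_scale {X : Type*} [PseudoMetricSpace X] {n : ℕ} {W : Set X}
    (h : UniformlyLC n W) : ∃ e : ℕ → ℝ, (∀ m, 0 < e m) ∧ (∀ m, e (m + 1) ≤ e m / 2) ∧
      Tendsto e atTop (𝓝 0) ∧ ∀ m, ∀ x, ∀ i ≤ n,
        SpheresFill i (ball x (2 * e (m + 1)) ∩ W) (ball x (e m / 2) ∩ W) := by
  refine exists_seq_pos_halving (P := fun _ a b => ∀ x, ∀ i ≤ n,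
    SpheresFill i (ball x (2 * b) ∩ W) (ball x (a / 2) ∩ W)) fun _ a ha => ?_
  obtain ⟨δ, hδ, hfill⟩ := h (a / 2) (half_pos ha)
  filter_upwards [Ioo_mem_nhdsGT (half_pos hδ)] with b hb x i hi
  exact (hfill x i hi).mono
    (inter_subset_inter_left _ (ball_subset_ball (by linarith [hb.2]))) subset_rfl

end UniformLocalConnectivity

section Covers

open scoped Classical in
/-- A finite open cover of `X` no point of which lies in more than `n + 1` members. -/
structure FiniteOpenCover (X : Type*) [TopologicalSpace X] (n : ℕ) where
  members : Finset (Set X)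
  isOpen_of_mem : ∀ A ∈ members, IsOpen A
  exists_mem : ∀ x, ∃ A ∈ members, x ∈ A
  card_le : ∀ x, {A ∈ members | x ∈ A}.card ≤ n + 1

namespace FiniteOpenCover

variable {X : Type*} [TopologicalSpace X] {n : ℕ}

open scoped Classical in
/-- The members of the cover that contain the point `x`. -/
noncomputable def star (U : FiniteOpenCover X n) (x : X) : Finset U.members :=
  {A | x ∈ A.1}

theorem mem_star {U : FiniteOpenCover X n} {x : X} {A : U.members} : A ∈ U.star x ↔ x ∈ A.1 := by
  classical exact Finset.mem_filter_univ A

theorem card_star_le (U : FiniteOpenCover X n) (x : X) : (U.star x).card ≤ n + 1 := by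
  classical
  refine le_trans (Finset.card_le_card_of_injOn Subtype.val (fun A hA => ?_)
    Subtype.val_injective.injOn) (U.card_le x)
  exact Finset.mem_filter.2 ⟨A.2, mem_star.1 hA⟩

instance : Inhabited (FiniteOpenCover X n) where
  default := {
    members := {univ}
    isOpen_of_mem := fun A hA => Finset.mem_singleton.1 hA ▸ isOpen_univ
    exists_mem := fun x => ⟨univ, Finset.mem_singleton_self _, mem_univ x⟩
    card_le := fun x => by classical exact (Finset.card_filter_le _ _).trans (by simp) }

end FiniteOpenCover

variable {X : Type*} [PseudoMetricSpace X] [CompactSpace X] {n : ℕ}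

theorem CoveringDimLE.exists_refinement (hdim : CoveringDimLE n X) (U : FiniteOpenCover X n)
    {ε : ℝ} (hε : 0 < ε) :
    ∃ V : FiniteOpenCover X n, (∀ A ∈ V.members, ∃ B ∈ U.members, A ⊆ B) ∧
      ∀ A ∈ V.members, ∀ x ∈ A, ∀ y ∈ A, dist x y < ε := by
  classical
  obtain ⟨t, ht, htX⟩ := totallyBounded_iff.1 (isCompact_univ (X := X)).totallyBounded
    (ε / 2) (half_pos hε)
  obtain ⟨V, hV, hVo, hVX, hVU, hVn⟩ := hdim
    (image2 (fun B c => B ∩ ball c (ε / 2)) U.members t) (U.members.finite_toSet.image2 _ ht)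
    (by rintro _ ⟨B, hB, c, -, rfl⟩; exact (U.isOpen_of_mem B hB).inter isOpen_ball)
    (eq_univ_of_forall fun x => by
      obtain ⟨B, hB, hxB⟩ := U.exists_mem x
      obtain ⟨c, hc, hxc⟩ := mem_iUnion₂.1 (htX (mem_univ x))
      exact ⟨_, mem_image2_of_mem hB hc, hxB, hxc⟩)
  refine ⟨⟨hV.toFinset, fun A hA => hVo A (hV.mem_toFinset.1 hA), fun x => ?_, fun x => ?_⟩,
    fun A hA => ?_, fun A hA x hx y hy => ?_⟩
  · obtain ⟨A, hA, hxA⟩ := mem_sUnion.1 (hVX ▸ mem_univ x)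
    exact ⟨A, hV.mem_toFinset.2 hA, hxA⟩
  · have h := hVn x
    have heq : ({A ∈ hV.toFinset | x ∈ A} : Finset (Set X)) = {A ∈ V | x ∈ A} := by
      ext A
      simp
    rw [← heq, encard_coe_eq_coe_finsetCard] at h
    exact_mod_cast h
  · obtain ⟨_, ⟨B, hB, c, -, rfl⟩, hAB⟩ := hVU A (hV.mem_toFinset.1 hA)
    exact ⟨B, hB, hAB.trans inter_subset_left⟩
  · obtain ⟨_, ⟨B, -, c, -, rfl⟩, hAB⟩ := hVU A (hV.mem_toFinset.1 hA)
    have hxc := mem_ball.1 (hAB hx).2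
    have hyc := mem_ball.1 (hAB hy).2
    linarith [dist_triangle_right x y c]

theorem CoveringDimLE.exists_seq_refinement (hdim : CoveringDimLE n X) {ε : ℕ → ℝ}
    (hε : ∀ k, 0 < ε k) :
    ∃ C : ℕ → FiniteOpenCover X n,
      (∀ k, ∀ A ∈ (C (k + 1)).members, ∃ B ∈ (C k).members, A ⊆ B) ∧
      ∀ k, ∀ A ∈ (C k).members, ∀ x ∈ A, ∀ y ∈ A, dist x y < ε k := by
  choose refine hrefine hmesh using fun k U => hdim.exists_refinement U (hε k)
  let C : ℕ → FiniteOpenCover X n := fun k => Nat.rec default refine k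
  exact ⟨fun k => C (k + 1), fun k => hrefine (k + 1) (C (k + 1)), fun k => hmesh k (C k)⟩

end Covers

section NerveRealization

variable {X : Type*} [PseudoMetricSpace X] {n : ℕ}

/-- The complex whose vertices are the pairs `(k, A)` with `A` a member of the `k`-th cover, and
whose simplices are the finite sets of vertices with a common point. It contains the nerves of all
covers and the mapping cylinders of the bonding maps between consecutive nerves. -/
def telescopeNerve (C : ℕ → FiniteOpenCover X n) : Set (Finset (ℕ × Set X)) :=
  {σ | ∃ z, ∀ q ∈ σ, q.2 ∈ (C q.1).members ∧ z ∈ q.2}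

theorem isLowerSet_telescopeNerve (C : ℕ → FiniteOpenCover X n) : IsLowerSet (telescopeNerve C) :=
  fun _ _ hτσ ⟨z, hz⟩ => ⟨z, fun q hq => hz q (hτσ hq)⟩

/-- The part in `W` of the union of the balls around the points `w q`, `q ∈ σ`, where the scale of
the ball at a vertex of level `k` is `e (k + r)`. -/
def scaledCarrier (W : Set X) (e : ℕ → ℝ) (w : ℕ × Set X → X) (r : ℕ) (σ : Finset (ℕ × Set X)) :
    Set X :=
  (⋃ q ∈ σ, ball (w q) (e (q.1 + r))) ∩ W

variable {W : Set X} {e : ℕ → ℝ} {w : ℕ × Set X → X}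

theorem monotone_scaledCarrier (r : ℕ) : Monotone (scaledCarrier W e w r) := fun _ _ hστ =>
  inter_subset_inter_left _ (biUnion_subset_biUnion_left hστ)

theorem spheresFill_scaledCarrier (he_pos : ∀ m, 0 < e m) (he_half : ∀ m, e (m + 1) ≤ e m / 2)
    {i : ℕ} (hfill : ∀ m x, SpheresFill i (ball x (2 * e (m + 1)) ∩ W) (ball x (e m / 2) ∩ W))
    {r : ℕ} {σ : Finset (ℕ × Set X)} {z : X}
    (hz : ∀ q ∈ σ, dist (w q) z < e (q.1 + r + 1) / 2) :
    SpheresFill i (scaledCarrier W e w (r + 1) σ) (scaledCarrier W e w r σ) := by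
  rcases σ.eq_empty_or_nonempty with rfl | hσ
  · simpa [scaledCarrier] using SpheresFill.of_empty_left
  have he_anti : Antitone e := antitone_nat_of_succ_le fun m => by linarith [he_half m, he_pos m]
  obtain ⟨q₀, hq₀, hmin⟩ := σ.exists_min_image Prod.fst hσ
  refine (hfill (q₀.1 + r) z).mono (inter_subset_inter_left _ (iUnion₂_subset fun q hq => ?_))
    (inter_subset_inter_left _ (subset_iUnion₂_of_subset q₀ hq₀ ?_))
  · have hle : e (q.1 + r + 1) ≤ e (q₀.1 + r + 1) := he_anti (by have := hmin q hq; omega)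
    exact ball_subset_ball' (by rw [← add_assoc]; linarith [hz q hq, he_pos (q₀.1 + r + 1)])
  · refine ball_subset_ball' ?_
    rw [dist_comm]
    linarith [hz q₀ hq₀, he_half (q₀.1 + r), he_pos (q₀.1 + r)]

theorem exists_realization_telescopeNerve [Nonempty X] (hW : Dense W) (he_pos : ∀ m, 0 < e m)
    (he_half : ∀ m, e (m + 1) ≤ e m / 2)
    (hfill : ∀ m x, ∀ i ≤ n, SpheresFill i (ball x (2 * e (m + 1)) ∩ W) (ball x (e m / 2) ∩ W))
    {C : ℕ → FiniteOpenCover X n}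
    (hmesh : ∀ k, ∀ A ∈ (C k).members, ∀ x ∈ A, ∀ y ∈ A, dist x y < e (k + n + 1) / 2) :
    ∃ F : (ℕ × Set X → ℝ) → X, ∀ σ : Finset (ℕ × Set X), σ.card ≤ n + 2 → ∀ k z,
      (∀ q ∈ σ, k ≤ q.1 ∧ q.2 ∈ (C q.1).members ∧ z ∈ q.2) → ContinuousOn F (simplexFace σ) ∧
        ∀ x ∈ simplexFace σ, F x ∈ W ∧ dist (F x) z ≤ 2 * e k := by
  have he_anti : Antitone e := antitone_nat_of_succ_le fun m => by linarith [he_half m, he_pos m]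
  have hvertex : ∀ q : ℕ × Set X, q.2 ∈ (C q.1).members → q.2.Nonempty → ∃ w, w ∈ q.2 ∩ W :=
    fun q hq hne => hW.inter_open_nonempty _ ((C q.1).isOpen_of_mem _ hq) hne
  choose! w hw using hvertex
  have hdist {q : ℕ × Set X} {z : X} (hz : q.2 ∈ (C q.1).members ∧ z ∈ q.2) :
      dist (w q) z < e (q.1 + n + 1) / 2 :=
    hmesh _ _ hz.1 _ (hw q hz.1 ⟨z, hz.2⟩).1 _ hz.2
  -- At a vertex of level `k`, the `j`-skeleton lives at scale `e (k + n + 1 - j)`: filling a sphere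
  -- costs one scale.
  obtain ⟨F, hF⟩ := exists_isCarriedOn (isLowerSet_telescopeNerve C)
    (Φ := fun j => scaledCarrier W e w (n + 1 - j)) (fun j => monotone_scaledCarrier _)
    (fun q ⟨z, hz⟩ => by
      obtain ⟨hq, hzq⟩ := hz q (Finset.mem_singleton_self q)
      exact ⟨w q, mem_biUnion (Finset.mem_singleton_self q) (mem_ball_self (he_pos _)),
        (hw q hq ⟨z, hzq⟩).2⟩)
    (n + 1) fun j hj σ ⟨z, hz⟩ => by
      rw [show n + 1 - j = n - j + 1 by omega, show n + 1 - (j + 1) = n - j by omega]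
      refine spheresFill_scaledCarrier he_pos he_half (fun m x => hfill m x j (by omega))
        fun q hq => (hdist (hz q hq)).trans_le ?_
      linarith [he_anti (show q.1 + (n - j) + 1 ≤ q.1 + n + 1 by omega)]
  refine ⟨F, fun σ hσ k z hz => ?_⟩
  obtain ⟨hFσ, hFcarrier⟩ := hF σ ⟨z, fun q hq => (hz q hq).2⟩ hσ
  refine ⟨hFσ, fun x hx => ⟨(hFcarrier hx).2, ?_⟩⟩
  obtain ⟨q, hq, hxq⟩ := mem_iUnion₂.1 (hFcarrier hx).1
  rw [Nat.sub_self, add_zero, mem_ball] at hxq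
  linarith [dist_triangle (F x) (w q) z, hdist (hz q hq).2, he_anti (hz q hq).1,
    he_anti (show q.1 ≤ q.1 + n + 1 by omega), he_pos q.1]

open FiniteOpenCover in
open scoped Classical in
theorem exists_telescope_realization [CompactSpace X] [Nonempty X] (hdim : CoveringDimLE n X)
    (hW : Dense W) (hWLC : UniformlyLC n W) :
    ∃ (C : ℕ → FiniteOpenCover X n) (F : (ℕ × Set X → ℝ) → X) (η : ℕ → ℝ),
      (∀ k, ∀ A ∈ (C (k + 1)).members, ∃ B ∈ (C k).members, A ⊆ B) ∧ Tendsto η atTop (𝓝 0) ∧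
      ∀ k x, ∀ σ ⊆ ((C k).star x).image (fun A => (k, A.1)) ∪
          ((C (k + 1)).star x).image (fun A => (k + 1, A.1)), σ.card ≤ n + 2 →
        ContinuousOn F (simplexFace σ) ∧ ∀ ξ ∈ simplexFace σ, F ξ ∈ W ∧ dist (F ξ) x ≤ η k := by
  obtain ⟨e, he_pos, he_half, he, hfill⟩ := hWLC.exists_scale
  obtain ⟨C, hC, hmesh⟩ := hdim.exists_seq_refinement fun k => half_pos (he_pos (k + n + 1))
  obtain ⟨F, hF⟩ := exists_realization_telescopeNerve hW he_pos he_half hfill hmesh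
  refine ⟨C, F, fun k => 2 * e k, hC, by simpa using he.const_mul 2, fun k x σ hσ hcard =>
    hF σ hcard k x fun q hq => ?_⟩
  rcases Finset.mem_union.1 (hσ hq) with h | h <;> obtain ⟨A, hA, rfl⟩ := Finset.mem_image.1 h
  exacts [⟨le_rfl, A.2, mem_star.1 hA⟩, ⟨k.le_succ, A.2, mem_star.1 hA⟩]

end NerveRealization

section Prism

variable {α ι : Type*} [Fintype α]

theorem single_mem_simplexFace [DecidableEq ι] {σ : Finset ι} {i : ι} (hi : i ∈ σ) :
    Pi.single i 1 ∈ simplexFace σ := by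
  have hnonneg : (0 : ι → ℝ) ≤ Pi.single i 1 := Pi.single_nonneg.2 zero_le_one
  refine ⟨hnonneg, fun j hj => ?_, ?_⟩
  · exact Pi.single_eq_of_ne (ne_of_mem_of_not_mem hi hj).symm _
  · rw [Finset.sum_pi_single', if_pos hi]

open scoped Classical in
/-- The affine map between simplices given by the vertex map `f`, in barycentric coordinates. -/
noncomputable def simplexMap (f : α → ι) (θ : α → ℝ) : ι → ℝ :=
  ∑ i, θ i • Pi.single (f i) 1

@[fun_prop]
theorem continuous_simplexMap (f : α → ι) : Continuous (simplexMap f) := by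
  unfold simplexMap
  fun_prop

theorem simplexMap_mem [DecidableEq ι] (f : α → ι) {A : Finset α} {θ : α → ℝ}
    (hθ : θ ∈ simplexFace A) : simplexMap f θ ∈ simplexFace (A.image f) := by
  have hsum : simplexMap f θ = ∑ i ∈ A, θ i • Pi.single (f i) 1 := by
    rw [simplexMap, ← Finset.sum_subset A.subset_univ fun i _ hi => by rw [hθ.2.1 i hi, zero_smul]]
    congr!
  rw [hsum]
  exact (convex_simplexFace _).sum_mem (fun i _ => hθ.1 i) hθ.2.2 fun i hi =>
    single_mem_simplexFace (Finset.mem_image_of_mem f hi)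

variable [LinearOrder α]

/-- The total mass at the points preceding `i`. -/
def massBefore (θ : α → ℝ) (i : α) : ℝ :=
  ∑ j with j < i, θ j

/-- The part of the mass at `i` among the first `t` units, when the masses `θ` are arranged along a
line in increasing order of `i`. -/
def initialMass (t : ℝ) (θ : α → ℝ) (i : α) : ℝ :=
  min (massBefore θ i + θ i) t - min (massBefore θ i) t

/-- A point of the prism over the simplex on `α`, lying above `θ`: as `t` goes from `0` to `1`, mass
is moved from the left copy of `α` to the right one, vertex after vertex. This is the staircase
triangulation of the prism. -/
def prismPoint (t : ℝ) (θ : α → ℝ) : α ⊕ α → ℝ :=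
  Sum.elim (θ - initialMass t θ) (initialMass t θ)

theorem continuous_prismPoint : Continuous fun q : ℝ × (α → ℝ) => prismPoint q.1 q.2 := by
  refine continuous_pi fun i => ?_
  rcases i with i | i <;> simp only [prismPoint, initialMass, massBefore, Sum.elim_inl,
    Sum.elim_inr, Pi.sub_apply] <;> fun_prop

variable {t : ℝ} {θ : α → ℝ} {A : Finset α}

theorem initialMass_nonneg (hθ : ∀ i, 0 ≤ θ i) (t : ℝ) (i : α) : 0 ≤ initialMass t θ i :=
  sub_nonneg.2 (min_le_min_right t (le_add_of_nonneg_right (hθ i)))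

theorem initialMass_le (hθ : ∀ i, 0 ≤ θ i) (t : ℝ) (i : α) : initialMass t θ i ≤ θ i := by
  have := hθ i
  unfold initialMass
  grind

theorem massBefore_add_le (hθ : ∀ i, 0 ≤ θ i) {i j : α} (hij : i < j) :
    massBefore θ i + θ i ≤ massBefore θ j := by
  rw [massBefore, add_comm, ← Finset.sum_insert (by simp)]
  refine Finset.sum_le_sum_of_subset_of_nonneg (fun l hl => ?_) fun l _ _ => hθ l
  simp only [Finset.mem_insert, Finset.mem_filter_univ] at hl ⊢
  rcases hl with rfl | hl
  exacts [hij, hl.trans hij]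

theorem card_initialMass_lt_le_one (hθ : ∀ i, 0 ≤ θ i) (t : ℝ) :
    ({i | 0 < initialMass t θ i ∧ initialMass t θ i < θ i} : Finset α).card ≤ 1 := by
  have hlt {i j : α} (hi : initialMass t θ i < θ i) (hj : 0 < initialMass t θ j) : ¬ i < j := by
    intro hij
    have := massBefore_add_le hθ hij
    unfold initialMass at hi hj
    grind
  refine Finset.card_le_one.2 fun i hi j hj => ?_
  rw [Finset.mem_filter_univ] at hi hj
  exact le_antisymm (not_lt.1 (hlt hj.2 hi.1)) (not_lt.1 (hlt hi.2 hj.1))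

theorem prismPoint_of_nonpos (hθ : ∀ i, 0 ≤ θ i) (ht : t ≤ 0) :
    prismPoint t θ = Sum.elim θ (0 : α → ℝ) := by
  have h : initialMass t θ = 0 := funext fun i => by
    have hb : 0 ≤ massBefore θ i := Finset.sum_nonneg fun j _ => hθ j
    rw [initialMass, min_eq_right (ht.trans (add_nonneg hb (hθ i))), min_eq_right (ht.trans hb),
      sub_self, Pi.zero_apply]
  rw [prismPoint, h, sub_zero]

theorem prismPoint_of_one_le (hθ : θ ∈ simplexFace A) (ht : 1 ≤ t) :
    prismPoint t θ = Sum.elim (0 : α → ℝ) θ := by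
  have h : initialMass t θ = θ := funext fun i => by
    have hle : massBefore θ i + θ i ≤ t := by
      rw [massBefore, add_comm, ← Finset.sum_insert (by simp)]
      refine le_trans ?_ (hθ.2.2.trans_le ht)
      rw [Finset.sum_subset A.subset_univ fun i _ hi => hθ.2.1 i hi]
      exact Finset.sum_le_univ_sum_of_nonneg hθ.1
    rw [initialMass, min_eq_left hle, min_eq_left (by linarith [hθ.1 i]), add_sub_cancel_left]
  rw [prismPoint, h, sub_self]

theorem exists_prismPoint_mem (hθ : θ ∈ simplexFace A) (t : ℝ) :
    ∃ τ ⊆ A.disjSum A, τ.card ≤ A.card + 1 ∧ prismPoint t θ ∈ simplexFace τ := by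
  have hpos := initialMass_nonneg hθ.1 t
  have hle := initialMass_le hθ.1 t
  let L : Finset α := {i ∈ A | initialMass t θ i < θ i}
  let R : Finset α := {i ∈ A | 0 < initialMass t θ i}
  refine ⟨L.disjSum R, Finset.disjSum_mono (Finset.filter_subset _ _) (Finset.filter_subset _ _),
    ?_, ?_, ?_, ?_⟩
  · rw [Finset.card_disjSum, ← Finset.card_union_add_card_inter]
    refine add_le_add (Finset.card_le_card (Finset.union_subset (Finset.filter_subset _ _)
      (Finset.filter_subset _ _))) (le_trans (Finset.card_le_card fun i hi => ?_)
      (card_initialMass_lt_le_one hθ.1 t))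
    simp only [L, R, Finset.mem_inter, Finset.mem_filter] at hi
    exact Finset.mem_filter_univ _ |>.2 ⟨hi.2.2, hi.1.2⟩
  · rintro (i | i)
    exacts [sub_nonneg.2 (hle i), hpos i]
  · rintro (i | i) hi <;>
      simp only [L, R, Finset.inl_mem_disjSum, Finset.inr_mem_disjSum, Finset.mem_filter,
        not_and, not_lt, prismPoint, Sum.elim_inl, Sum.elim_inr, Pi.sub_apply] at hi ⊢ <;>
      by_cases hiA : i ∈ A <;> grind [hθ.2.1 i]
  · have hL : ∑ i ∈ L, (θ i - initialMass t θ i) = ∑ i ∈ A, (θ i - initialMass t θ i) :=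
      Finset.sum_filter_of_ne fun i _ hi => (hle i).lt_of_ne fun h => hi (sub_eq_zero.2 h.symm)
    have hR : ∑ i ∈ R, initialMass t θ i = ∑ i ∈ A, initialMass t θ i :=
      Finset.sum_filter_of_ne fun i _ hi => (hpos i).lt_of_ne' hi
    simp only [Finset.sum_disjSum, prismPoint, Sum.elim_inl, Sum.elim_inr, Pi.sub_apply]
    rw [hL, hR, ← Finset.sum_add_distrib]
    simpa using hθ.2.2

end Prism

section MappingCylinder

theorem simplexMap_sumElim {α β ι : Type*} [Fintype α] [Fintype β] (f : α → ι) (g : β → ι)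
    (θ : α → ℝ) (θ' : β → ℝ) :
    simplexMap (Sum.elim f g) (Sum.elim θ θ') = simplexMap f θ + simplexMap g θ' := by
  simp [simplexMap]

theorem simplexMap_zero {α ι : Type*} [Fintype α] (f : α → ι) : simplexMap f 0 = 0 := by
  simp [simplexMap]

theorem exists_prism_slide {α ι : Type*} [Fintype α] [DecidableEq ι] (f g : α → ι) :
    ∃ Ψ : ℝ → (α → ℝ) → ι → ℝ, (Continuous fun q : ℝ × (α → ℝ) => Ψ q.1 q.2) ∧
      ∀ A, ∀ θ ∈ simplexFace A, (∀ t ≤ 0, Ψ t θ = simplexMap f θ) ∧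
        (∀ t ≥ 1, Ψ t θ = simplexMap g θ) ∧
        ∀ t, ∃ τ ⊆ A.image f ∪ A.image g, τ.card ≤ A.card + 1 ∧ Ψ t θ ∈ simplexFace τ := by
  let _ : LinearOrder α := IsWellOrder.linearOrder WellOrderingRel
  refine ⟨fun t θ => simplexMap (Sum.elim f g) (prismPoint t θ),
    (continuous_simplexMap _).comp continuous_prismPoint, fun A θ hθ =>
      ⟨fun t ht => ?_, fun t ht => ?_, fun t => ?_⟩⟩
  · beta_reduce
    rw [prismPoint_of_nonpos hθ.1 ht, simplexMap_sumElim, simplexMap_zero, add_zero]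
  · beta_reduce
    rw [prismPoint_of_one_le hθ ht, simplexMap_sumElim, simplexMap_zero, zero_add]
  · obtain ⟨τ, hτA, hτ, hmem⟩ := exists_prismPoint_mem hθ t
    refine ⟨τ.image (Sum.elim f g), (Finset.image_mono _ hτA).trans ?_,
      Finset.card_image_le.trans hτ, simplexMap_mem _ hmem⟩
    rintro _ h
    simpa [Finset.mem_image] using h

theorem exists_cylinder_path {α β ι : Type*} [Fintype α] [Fintype β] [DecidableEq ι] (p : β → α)
    (f : α → ι) (g : β → ι) :
    ∃ Θ : ℝ → (α → ℝ) → (β → ℝ) → ι → ℝ,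
      (Continuous fun q : ℝ × (α → ℝ) × (β → ℝ) => Θ q.1 q.2.1 q.2.2) ∧
      ∀ A B, ∀ θ ∈ simplexFace A, ∀ θ' ∈ simplexFace B,
        Θ 0 θ θ' = simplexMap f θ ∧ Θ 1 θ θ' = simplexMap g θ' ∧
        (MapsTo p B A → ∀ t ∈ Icc (0 : ℝ) 1, ∃ σ ⊆ A.image f ∪ B.image g,
          σ.card ≤ max A.card (B.card + 1) ∧ Θ t θ θ' ∈ simplexFace σ) := by
  -- Move linearly from `θ` to the push-forward of `θ'` inside one simplex, then slide up the prism.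
  obtain ⟨Ψ, hΨ, hΨmem⟩ := exists_prism_slide (f ∘ p) g
  refine ⟨fun t θ θ' => AffineMap.lineMap (simplexMap f θ) (Ψ (2 * t - 1) θ') (min 1 (2 * t)),
    ?_, fun A B θ hθ θ' hθ' => ?_⟩
  · have : Continuous fun q : ℝ × (α → ℝ) × (β → ℝ) => Ψ (2 * q.1 - 1) q.2.2 :=
      hΨ.comp (f := fun q : ℝ × (α → ℝ) × (β → ℝ) => (2 * q.1 - 1, q.2.2)) (by fun_prop)
    simp only [AffineMap.lineMap_apply_module]
    fun_prop
  obtain ⟨hΨ0, hΨ1, hΨt⟩ := hΨmem B θ' hθ'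
  beta_reduce
  refine ⟨by simp, ?_, fun hp t ht => ?_⟩
  · rw [hΨ1 (2 * 1 - 1) (by norm_num), mul_one, min_eq_left one_le_two, AffineMap.lineMap_apply_one]
  have hfp : B.image (f ∘ p) ⊆ A.image f := by
    rw [Finset.image_subset_iff]
    exact fun i hi => Finset.mem_image_of_mem f (hp hi)
  rcases le_total (2 * t) 1 with ht' | ht'
  · refine ⟨A.image f, Finset.subset_union_left, Finset.card_image_le.trans (le_max_left _ _), ?_⟩
    rw [min_eq_right ht', hΨ0 _ (by linarith)]
    exact (convex_simplexFace _).lineMap_mem (simplexMap_mem f hθ)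
      (simplexFace_mono hfp (simplexMap_mem _ hθ')) ⟨by linarith [ht.1], ht'⟩
  · obtain ⟨τ, hτ, hτB, hmem⟩ := hΨt (2 * t - 1)
    rw [min_eq_left ht', AffineMap.lineMap_apply_one]
    exact ⟨τ, hτ.trans (Finset.union_subset_union_left hfp), hτB.trans (le_max_right _ _), hmem⟩

end MappingCylinder

section Annuli

variable {X Y : Type*} {D : Y → ℝ} {ν : Y → X} {ρ η : ℕ → ℝ} {R : ℕ → Y → X}

/-- The annulus `ρ (k + 1) ≤ D ≤ ρ k` around the zero set of `D`. -/
def annulus (D : Y → ℝ) (ρ : ℕ → ℝ) (k : ℕ) : Set Y :=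
  D ⁻¹' Icc (ρ (k + 1)) (ρ k)

theorem exists_ge_mem_Ico (hρ0 : Tendsto ρ atTop (𝓝 0)) {d : ℝ} (hd : 0 < d) {m : ℕ}
    (hdm : d < ρ m) : ∃ k ≥ m, d ∈ Ico (ρ (k + 1)) (ρ k) := by
  have hex : ∃ j, ρ (m + j + 1) ≤ d := by
    obtain ⟨N, hN⟩ := eventually_atTop.1 (hρ0.eventually (gt_mem_nhds hd))
    exact ⟨N, (hN _ (by omega)).le⟩
  classical
  refine ⟨m + Nat.find hex, Nat.le_add_right _ _, Nat.find_spec hex, ?_⟩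
  rcases h : Nat.find hex with _ | j
  · exact hdm
  · exact not_le.1 (Nat.find_min hex (h ▸ j.lt_succ_self))

theorem exists_glue_annuli (hρ : StrictAnti ρ) (hρpos : ∀ k, 0 < ρ k)
    (hR : ∀ k y, D y = ρ (k + 1) → R k y = R (k + 1) y) :
    ∃ g : Y → X, (∀ k, EqOn g (R k) (annulus D ρ k)) ∧ ∀ y, D y = 0 → g y = ν y := by
  have hcompat : ∀ y k l, k < l → y ∈ annulus D ρ k → y ∈ annulus D ρ l → R k y = R l y := by
    intro y k l hkl hk hl
    have hρl : ρ (k + 1) = ρ l := ((hk.1.trans hl.2).antisymm (hρ.antitone hkl))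
    obtain rfl : k + 1 = l := hρ.injective hρl
    exact hR k y (hl.2.antisymm hk.1)
  have hpoint : ∀ y, ∃ x, (∀ k, y ∈ annulus D ρ k → x = R k y) ∧ (D y = 0 → x = ν y) := by
    intro y
    by_cases hy : ∃ k, y ∈ annulus D ρ k
    · obtain ⟨k, hk⟩ := hy
      refine ⟨R k y, fun l hl => ?_, fun h => ((hρpos (k + 1)).not_ge (h ▸ hk.1)).elim⟩
      rcases lt_trichotomy k l with hkl | rfl | hlk
      exacts [hcompat y k l hkl hk hl, rfl, (hcompat y l k hlk hl hk).symm]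
    · exact ⟨ν y, fun k hk => (hy ⟨k, hk⟩).elim, fun _ => rfl⟩
  choose g hgR hgν using hpoint
  exact ⟨g, fun k y hy => hgR y k hy, hgν⟩

theorem continuousAt_of_continuousOn_annuli [TopologicalSpace X] [TopologicalSpace Y]
    (hD : Continuous D) (hρ : StrictAnti ρ) {g : Y → X}
    (hg : ∀ k, ContinuousOn g (annulus D ρ k)) {k : ℕ} {y : Y}
    (hy : D y ∈ Ico (ρ (k + 1)) (ρ k)) : ContinuousAt g y := by
  have hclosed : ∀ k, IsClosed (annulus D ρ k) := fun k => isClosed_Icc.preimage hD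
  refine ((hg k).union_of_isClosed (hg (k + 1)) (hclosed k) (hclosed (k + 1))).continuousAt ?_
  filter_upwards [hD.continuousAt.eventually (gt_mem_nhds hy.2),
    hD.continuousAt.eventually (lt_mem_nhds ((hρ (k + 1).lt_succ_self).trans_le hy.1))]
    with z hz hz'
  exact (le_total (ρ (k + 1)) (D z)).imp (fun h => ⟨h, hz.le⟩) fun h => ⟨hz'.le, h⟩

theorem continuousAt_of_dist_le_on_annuli [PseudoMetricSpace X] [TopologicalSpace Y]
    (hD : Continuous D) (hD0 : ∀ y, 0 ≤ D y) (hρpos : ∀ k, 0 < ρ k) (hρ0 : Tendsto ρ atTop (𝓝 0))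
    (hη : Tendsto η atTop (𝓝 0)) {g : Y → X}
    (hdist : ∀ k, ∀ y ∈ annulus D ρ k, dist (g y) (ν y) ≤ η k) (hgν : ∀ y, D y = 0 → g y = ν y)
    {y : Y} (hy : D y = 0) (hν : ContinuousAt ν y) : ContinuousAt g y := by
  refine continuousAt_iff'.2 fun ε hε => ?_
  rw [hgν y hy]
  obtain ⟨m, hm⟩ := eventually_atTop.1 (hη.eventually (gt_mem_nhds (half_pos hε)))
  filter_upwards [hD.continuousAt.eventually (gt_mem_nhds (hy.trans_lt (hρpos m))),
    continuousAt_iff'.1 hν _ (half_pos hε)] with z hzm hzν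
  have hgz : dist (g z) (ν z) < ε / 2 := by
    rcases (hD0 z).eq_or_lt with hz | hz
    · rw [hgν z hz.symm, dist_self]
      exact half_pos hε
    · obtain ⟨k, hkm, hzk⟩ := exists_ge_mem_Ico hρ0 hz hzm
      exact (hdist k z (Ico_subset_Icc_self hzk)).trans_lt (hm k hkm)
  linarith [dist_triangle (g z) (ν z) (ν y)]

theorem exists_continuousOn_of_annuli [PseudoMetricSpace X] [TopologicalSpace Y]
    (hD : Continuous D) (hD0 : ∀ y, 0 ≤ D y) (hρ : StrictAnti ρ) (hρpos : ∀ k, 0 < ρ k)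
    (hρ0 : Tendsto ρ atTop (𝓝 0)) (hη : Tendsto η atTop (𝓝 0))
    (hν : ∀ y, D y = 0 → ContinuousAt ν y) (hRc : ∀ k, ContinuousOn (R k) (annulus D ρ k))
    (hRν : ∀ k, ∀ y ∈ annulus D ρ k, dist (R k y) (ν y) ≤ η k)
    (hR : ∀ k y, D y = ρ (k + 1) → R k y = R (k + 1) y) :
    ∃ g : Y → X, ContinuousOn g {y | D y < ρ 0} ∧ (∀ k, EqOn g (R k) (annulus D ρ k)) ∧
      ∀ y, D y = 0 → g y = ν y := by
  obtain ⟨g, hgR, hgν⟩ := exists_glue_annuli (ν := ν) hρ hρpos hR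
  refine ⟨g, fun y hy => ContinuousAt.continuousWithinAt ?_, hgR, hgν⟩
  rcases (hD0 y).eq_or_lt with h | h
  · exact continuousAt_of_dist_le_on_annuli hD hD0 hρpos hρ0 hη
      (fun k z hz => hgR k hz ▸ hRν k z hz) hgν h.symm (hν y h.symm)
  · obtain ⟨k, -, hk⟩ := exists_ge_mem_Ico hρ0 h hy
    exact continuousAt_of_continuousOn_annuli hD hρ (fun k => (hRc k).congr (hgR k)) hk

end Annuli

section NearestPoints

theorem exists_leftInverse_continuousAt_of_isometry {X Y : Type*} [MetricSpace X] [CompactSpace X]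
    [Nonempty X] [PseudoMetricSpace Y] {e : X → Y} (he : Isometry e) :
    ∃ ν : Y → X, Function.LeftInverse ν e ∧ ∀ x, ContinuousAt ν (e x) := by
  have hnearest : ∀ y, ∃ x, infDist y (range e) = dist y (e x) := fun y => by
    obtain ⟨_, ⟨x, rfl⟩, hx⟩ :=
      (isCompact_range he.continuous).exists_infDist_eq_dist (range_nonempty e) y
    exact ⟨x, hx⟩
  choose ν hν using hnearest
  have hdist : ∀ y x, dist (ν y) x ≤ 2 * dist y (e x) := fun y x => by
    have hle : dist y (e (ν y)) ≤ dist y (e x) := hν y ▸ infDist_le_dist_of_mem ⟨x, rfl⟩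
    rw [← he.dist_eq]
    linarith [dist_triangle_left (e (ν y)) (e x) y]
  have hleft : Function.LeftInverse ν e := fun x => dist_le_zero.1 (by simpa using hdist (e x) x)
  refine ⟨ν, hleft, fun x => ?_⟩
  rw [ContinuousAt, hleft x, tendsto_iff_dist_tendsto_zero]
  refine squeeze_zero (fun _ => dist_nonneg) (fun y => hdist y x) ?_
  exact Continuous.tendsto' (by fun_prop) _ _ (by simp)

theorem exists_strictAnti_infDist_le_subset {Y : Type*} [PseudoMetricSpace Y] {K : Set Y}
    (hK : IsCompact K) (hne : K.Nonempty) {O : ℕ → Set Y} (hO : ∀ k, IsOpen (O k))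
    (hKO : ∀ k, K ⊆ O k) :
    ∃ ρ : ℕ → ℝ, StrictAnti ρ ∧ (∀ k, 0 < ρ k) ∧ Tendsto ρ atTop (𝓝 0) ∧
      ∀ k y, infDist y K ≤ ρ k → y ∈ O k := by
  choose δ hδ hδO using fun k => hK.exists_thickening_subset_open (hO k) (hKO k)
  obtain ⟨ρ, hρpos, hρhalf, hρ0, hρδ⟩ := exists_seq_pos_halving
    (P := fun k _ b => b < δ k) fun k _ _ => nhdsWithin_le_nhds (gt_mem_nhds (hδ k))
  have hρ : StrictAnti ρ := strictAnti_nat_of_succ_lt fun k =>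
    (hρhalf k).trans_lt (half_lt_self (hρpos k))
  refine ⟨fun k => ρ (k + 1), fun i j hij => hρ (Nat.succ_lt_succ hij), fun k => hρpos _,
    hρ0.comp (tendsto_add_atTop_nat 1), fun k y hy => hδO k ?_⟩
  exact mem_thickening_iff_infDist_lt hne |>.2 (hy.trans_lt (hρδ k))

end NearestPoints

section Retraction

open FiniteOpenCover (mem_star)

theorem FiniteOpenCover.exists_weights {X Y : Type*} [TopologicalSpace X] [TopologicalSpace Y]
    [NormalSpace Y] {n : ℕ} (U : FiniteOpenCover X n) {ν : Y → X} {K : Set Y} (hK : IsClosed K)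
    (hcov : K ⊆ ⋃ A ∈ U.members, interior (ν ⁻¹' A)) :
    ∃ θ : Y → U.members → ℝ, Continuous θ ∧ ∀ y ∈ K, θ y ∈ simplexFace (U.star (ν y)) := by
  obtain ⟨f, hf⟩ := PartitionOfUnity.exists_isSubordinate_of_locallyFinite hK
    (fun A : U.members => interior (ν ⁻¹' A)) (fun _ => isOpen_interior)
    (locallyFinite_of_finite _) (by simpa only [iUnion_subtype] using hcov)
  have hzero : ∀ y, ∀ A ∉ U.star (ν y), f A y = 0 := fun y A hA => by
    by_contra h
    have hy : y ∈ interior (ν ⁻¹' A) := hf A (subset_tsupport _ h)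
    exact hA (mem_star.2 (interior_subset hy : y ∈ ν ⁻¹' A))
  refine ⟨fun y A => f A y, by fun_prop, fun y hy => ⟨fun A => f.nonneg A y, hzero y, ?_⟩⟩
  rw [Finset.sum_subset (Finset.subset_univ _) fun A _ hA => hzero y A hA,
    ← finsum_eq_sum_of_fintype]
  exact f.sum_eq_one hy

theorem FiniteOpenCover.subset_iUnion_interior_preimage {X Y : Type*} [TopologicalSpace X]
    [TopologicalSpace Y] {n : ℕ} (U : FiniteOpenCover X n) {e : X → Y} {ν : Y → X}
    (hνe : Function.LeftInverse ν e) (hν : ∀ x, ContinuousAt ν (e x)) :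
    range e ⊆ ⋃ A ∈ U.members, interior (ν ⁻¹' A) := by
  rintro _ ⟨x, rfl⟩
  obtain ⟨A, hA, hxA⟩ := U.exists_mem x
  exact mem_biUnion hA (mem_interior_iff_mem_nhds.2
    ((hν x).preimage_mem_nhds ((U.isOpen_of_mem A hA).mem_nhds ((hνe x).symm ▸ hxA))))

theorem FiniteOpenCover.exists_bridge {X ι : Type*} [TopologicalSpace X] [DecidableEq ι] {n : ℕ}
    {U V : FiniteOpenCover X n} (hVU : ∀ A ∈ V.members, ∃ B ∈ U.members, A ⊆ B)
    (f : U.members → ι) (g : V.members → ι) :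
    ∃ Θ : ℝ → (U.members → ℝ) → (V.members → ℝ) → ι → ℝ,
      (Continuous fun q : ℝ × (U.members → ℝ) × (V.members → ℝ) => Θ q.1 q.2.1 q.2.2) ∧
      ∀ x, ∀ θ ∈ simplexFace (U.star x), ∀ θ' ∈ simplexFace (V.star x),
        Θ 0 θ θ' = simplexMap f θ ∧ Θ 1 θ θ' = simplexMap g θ' ∧
        ∀ t ∈ Icc (0 : ℝ) 1, ∃ σ ⊆ (U.star x).image f ∪ (V.star x).image g,
          σ.card ≤ n + 2 ∧ Θ t θ θ' ∈ simplexFace σ := by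
  choose! p hp hAp using hVU
  obtain ⟨Θ, hΘ, hΘmem⟩ := exists_cylinder_path
    (fun A : V.members => (⟨p A, hp A A.2⟩ : U.members)) f g
  refine ⟨Θ, hΘ, fun x θ hθ θ' hθ' => ?_⟩
  obtain ⟨hΘ0, hΘ1, hΘt⟩ := hΘmem _ _ θ hθ θ' hθ'
  refine ⟨hΘ0, hΘ1, fun t ht => ?_⟩
  obtain ⟨σ, hσ, hcard, hmem⟩ := hΘt (fun A hA => mem_star.2 (hAp A A.2 (mem_star.1 hA))) t ht
  have := U.card_star_le x
  have := V.card_star_le x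
  exact ⟨σ, hσ, by omega, hmem⟩

theorem exists_map_annulus {X Y ι : Type*} [TopologicalSpace X] [TopologicalSpace Y]
    [DecidableEq ι] {n : ℕ} {U V : FiniteOpenCover X n}
    (hVU : ∀ A ∈ V.members, ∃ B ∈ U.members, A ⊆ B) {f : U.members → ι} {g : V.members → ι}
    {F : (ι → ℝ) → X} {Q : X → X → Prop}
    (hF : ∀ x, ∀ σ ⊆ (U.star x).image f ∪ (V.star x).image g, σ.card ≤ n + 2 →
      ContinuousOn F (simplexFace σ) ∧ ∀ ξ ∈ simplexFace σ, Q x (F ξ))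
    {D : Y → ℝ} (hD : Continuous D) {a b : ℝ} (hab : a < b) {ν : Y → X}
    {θ : Y → U.members → ℝ} (hθ : Continuous θ)
    (hθU : ∀ y, D y ≤ b → θ y ∈ simplexFace (U.star (ν y)))
    {θ' : Y → V.members → ℝ} (hθ' : Continuous θ')
    (hθV : ∀ y, D y ≤ b → θ' y ∈ simplexFace (V.star (ν y))) :
    ∃ R : Y → X, ContinuousOn R (D ⁻¹' Icc a b) ∧ (∀ y ∈ D ⁻¹' Icc a b, Q (ν y) (R y)) ∧
      (∀ y, D y = b → R y = F (simplexMap f (θ y))) ∧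
      ∀ y, D y = a → R y = F (simplexMap g (θ' y)) := by
  obtain ⟨Θ, hΘ, hΘmem⟩ := FiniteOpenCover.exists_bridge hVU f g
  let Ξ : Y → ι → ℝ := fun y => Θ ((b - D y) / (b - a)) (θ y) (θ' y)
  have hba : 0 < b - a := sub_pos.2 hab
  have hΞc : Continuous Ξ :=
    hΘ.comp (f := fun y => ((b - D y) / (b - a), θ y, θ' y)) (by fun_prop)
  have hΞ : ∀ y ∈ D ⁻¹' Icc a b, ∃ σ ⊆ (U.star (ν y)).image f ∪ (V.star (ν y)).image g,
      σ.card ≤ n + 2 ∧ Ξ y ∈ simplexFace σ := fun y hy =>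
    (hΘmem _ _ (hθU y hy.2) _ (hθV y hy.2)).2.2 _
      ⟨div_nonneg (sub_nonneg.2 hy.2) hba.le, (div_le_one hba).2 (by linarith [hy.1])⟩
  refine ⟨F ∘ Ξ, ?_, fun y hy => ?_, fun y hy => ?_, fun y hy => ?_⟩
  · refine ContinuousOn.comp (t := Ξ '' (D ⁻¹' Icc a b)) ?_ hΞc.continuousOn (mapsTo_image _ _)
    refine continuousOn_of_forall_exists_simplexFace
      (Finset.univ.image f ∪ Finset.univ.image g) ?_
    rintro _ ⟨y, hy, rfl⟩
    obtain ⟨σ, hσ, hcard, hmem⟩ := hΞ y hy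
    exact ⟨σ, hσ.trans (Finset.union_subset_union (Finset.image_mono _ (Finset.subset_univ _))
      (Finset.image_mono _ (Finset.subset_univ _))), hmem, (hF _ σ hσ hcard).1⟩
  · obtain ⟨σ, hσ, hcard, hmem⟩ := hΞ y hy
    exact (hF _ σ hσ hcard).2 _ hmem
  · simp only [Function.comp_apply, Ξ, hy, sub_self, zero_div]
    rw [(hΘmem _ _ (hθU y hy.le) _ (hθV y hy.le)).1]
  · have hyb : D y ≤ b := hy.trans_le hab.le
    simp only [Function.comp_apply, Ξ, hy, div_self hba.ne']
    rw [(hΘmem _ _ (hθU y hyb) _ (hθV y hyb)).2.1]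

theorem exists_seq_weights {X Y : Type*} [TopologicalSpace X] [CompactSpace X] [Nonempty X]
    [MetricSpace Y] {e : X → Y} (he : Continuous e) {ν : Y → X} (hνe : Function.LeftInverse ν e)
    (hν : ∀ x, ContinuousAt ν (e x)) {n : ℕ} (C : ℕ → FiniteOpenCover X n) :
    ∃ (ρ : ℕ → ℝ) (θ : ∀ k, Y → (C k).members → ℝ), StrictAnti ρ ∧ (∀ k, 0 < ρ k) ∧
      Tendsto ρ atTop (𝓝 0) ∧ (∀ k, Continuous (θ k)) ∧
      ∀ k y, infDist y (range e) ≤ ρ k → θ k y ∈ simplexFace ((C k).star (ν y)) ∧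
        θ (k + 1) y ∈ simplexFace ((C (k + 1)).star (ν y)) := by
  obtain ⟨ρ, hρ, hρpos, hρ0, hρcover⟩ := exists_strictAnti_infDist_le_subset
    (isCompact_range he) (range_nonempty e)
    (fun k => isOpen_biUnion fun A _ => isOpen_interior (s := ν ⁻¹' A))
    fun k => (C k).subset_iUnion_interior_preimage hνe hν
  choose θ hθ hθmem using fun k =>
    (C k).exists_weights (isClosed_le (continuous_infDist_pt (range e)) continuous_const)
      (fun y => hρcover k y)
  exact ⟨fun k => ρ (k + 1), θ, hρ.comp_strictMono fun i j hij => Nat.succ_lt_succ hij,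
    fun k => hρpos _, hρ0.comp (tendsto_add_atTop_nat 1), hθ, fun k y hy =>
      ⟨hθmem k y (hy.trans (hρ k.lt_succ_self).le), hθmem (k + 1) y hy⟩⟩

theorem exists_retraction_into {X Y : Type*} [MetricSpace X] [CompactSpace X] [Nonempty X]
    [MetricSpace Y] {e : X → Y} (he : Isometry e) {n : ℕ} (hdim : CoveringDimLE n X)
    {W : Set X} (hW : Dense W) (hWLC : UniformlyLC n W) :
    ∃ O : Set Y, IsOpen O ∧ range e ⊆ O ∧ ∃ r : Y → X, ContinuousOn r O ∧
      (∀ x, r (e x) = x) ∧ ∀ y ∈ O, y ∉ range e → r y ∈ W := by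
  classical
  obtain ⟨C, F, η, hC, hη, hF⟩ := exists_telescope_realization hdim hW hWLC
  obtain ⟨ν, hνe, hν⟩ := exists_leftInverse_continuousAt_of_isometry he
  obtain ⟨ρ, θ, hρ, hρpos, hρ0, hθ, hθmem⟩ := exists_seq_weights he.continuous hνe hν C
  let D : Y → ℝ := fun y => infDist y (range e)
  have hD : Continuous D := continuous_infDist_pt _
  have hDe : ∀ y, D y = 0 ↔ y ∈ range e := fun y =>
    ((isCompact_range he.continuous).isClosed.mem_iff_infDist_zero (range_nonempty e)).symm
  choose R hRc hRW hRout hRin using fun k =>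
    exists_map_annulus (Q := fun x y => y ∈ W ∧ dist y x ≤ η k) (hC k) (hF k) hD
      (hρ k.lt_succ_self) (hθ k) (fun y hy => (hθmem k y hy).1) (hθ (k + 1))
      fun y hy => (hθmem k y hy).2
  obtain ⟨r, hr, hrR, hrν⟩ := exists_continuousOn_of_annuli hD (fun _ => infDist_nonneg) hρ hρpos
    hρ0 hη (fun y hy => by obtain ⟨x, rfl⟩ := (hDe y).1 hy; exact hν x) hRc
    (fun k y hy => (hRW k y hy).2) fun k y hy => (hRin k y hy).trans (hRout (k + 1) y hy).symm
  refine ⟨{y | D y < ρ 0}, isOpen_lt hD continuous_const,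
    fun y hy => ((hDe y).2 hy).trans_lt (hρpos 0), r, hr,
    fun x => (hrν _ ((hDe _).2 ⟨x, rfl⟩)).trans (hνe x), fun y hy hye => ?_⟩
  have hDy : 0 < D y := infDist_nonneg.lt_of_ne' fun h => hye ((hDe y).1 h)
  obtain ⟨k, -, hk⟩ := exists_ge_mem_Ico hρ0 hDy hy
  have hyk : y ∈ annulus D ρ k := Ico_subset_Icc_self hk
  exact hrR k hyk ▸ (hRW k y hyk).1

end Retraction

theorem exists_neighborhood_retraction {X Y : Type*} [TopologicalSpace X] [CompactSpace X]
    [TopologicalSpace Y] [MetrizableSpace Y] {e : X → Y} (he : IsClosedEmbedding e) {n : ℕ}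
    (hdim : CoveringDimLE n X) {Z : Set X} (hZc : IsClosed Z) (hZn : IsNowhereDense Z)
    (hLCC : IsLCC n Z) (hLC : IsLC n (Zᶜ : Set X)) :
    ∃ O : Set Y, IsOpen O ∧ range e ⊆ O ∧ ∃ r : C(O, X),
      (∀ (x : X) (hx : e x ∈ O), r ⟨e x, hx⟩ = x) ∧ ∀ y : O, (y : Y) ∉ range e → r y ∉ Z := by
  rcases isEmpty_or_nonempty X with hX | hX
  · refine ⟨∅, isOpen_empty, ?_, ⟨fun y => y.2.elim, continuous_of_const fun y => y.2.elim⟩,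
      fun x => isEmptyElim x, fun y => y.2.elim⟩
    rintro _ ⟨x, -⟩
    exact isEmptyElim x
  let _ : MetricSpace Y := metrizableSpaceMetric Y
  let _ : MetricSpace X := he.isEmbedding.comapMetricSpace
  have hiso : Isometry e := Isometry.of_dist_eq fun x y => rfl
  have hdense : Dense Zᶜ := by
    rw [← interior_eq_empty_iff_dense_compl]
    exact hZc.isNowhereDense_iff.1 hZn
  obtain ⟨O, hO, heO, r, hr, hre, hrZ⟩ :=
    exists_retraction_into hiso hdim hdense (uniformlyLC_compl hZc hLCC hLC)
  exact ⟨O, hO, heO, ⟨fun y => r y, hr.comp_continuous continuous_subtype_val fun y => y.2⟩,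
    fun x _ => hre x, fun y hy => hrZ y y.2 hy⟩

theorem exists_pos_forall_mul_mem {X : Type*} [TopologicalSpace X] [CompactSpace X]
    {O : Set (X × unitInterval)} (hO : IsOpen O) (hXO : ∀ x, (x, 0) ∈ O) :
    ∃ c : unitInterval, 0 < c ∧ ∀ x t, (x, t * c) ∈ O := by
  have hnear : ∀ᶠ c in 𝓝 (0 : unitInterval), ∀ q ∈ (univ : Set (X × unitInterval)),
      (q.1, q.2 * c) ∈ O := by
    refine isCompact_univ.eventually_forall_of_forall_eventually fun q _ => ?_
    have hcont : Continuous fun p : unitInterval × X × unitInterval => (p.2.1, p.2.2 * p.1) := by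
      fun_prop
    exact hcont.continuousAt.eventually_mem (hO.mem_nhds (by simpa only [mul_zero] using hXO q.1))
  have hright : (𝓝[>] (0 : unitInterval)).NeBot := nhdsGT_neBot_of_exists_gt ⟨1, one_pos⟩
  obtain ⟨c, hc, hc0⟩ := ((eventually_nhdsWithin_of_eventually_nhds hnear).and
    (eventually_mem_nhdsWithin (s := Ioi 0))).exists
  exact ⟨c, hc0, fun x t => hc (x, t) (mem_univ _)⟩

-- A retraction of a neighborhood of `X × {0}` in `X × [0, 1]` onto `X` is the required homotopy.
theorem isZSet_of_isLCC {X : Type*} [TopologicalSpace X] [CompactSpace X] [MetrizableSpace X]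
    {n : ℕ} (hdim : CoveringDimLE n X) {Z : Set X} (hZc : IsClosed Z) (hZn : IsNowhereDense Z)
    (hLCC : IsLCC n Z) (hLC : IsLC n (Zᶜ : Set X)) : IsZSet Z := by
  have he : IsClosedEmbedding fun x : X => (x, (0 : unitInterval)) :=
    Continuous.isClosedEmbedding (by fun_prop) fun x y h => congrArg Prod.fst h
  obtain ⟨O, hO, heO, r, hr, hrZ⟩ := exists_neighborhood_retraction he hdim hZc hZn hLCC hLC
  have hXO : ∀ x : X, (x, 0) ∈ O := fun x => heO ⟨x, rfl⟩
  obtain ⟨c, hc, hcO⟩ := exists_pos_forall_mul_mem hO hXO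
  refine ⟨hZc, hZn, ⟨fun q => r ⟨(q.1, q.2 * c), hcO _ _⟩, by fun_prop⟩, fun x => ?_,
    fun x t ht => hrZ _ ?_⟩
  · simpa only [ContinuousMap.coe_mk, zero_mul] using hr x (hXO x)
  · rintro ⟨x', hx'⟩
    exact (unitInterval.pos_iff_ne_zero.1 (mul_pos ht hc)) (congrArg Prod.snd hx').symm

theorem IsZSet.id_nullhomotopic {X : Type*} [TopologicalSpace X] {Z : Set X} (hZ : IsZSet Z)
    [ContractibleSpace (Zᶜ : Set X)] : (ContinuousMap.id X).Nullhomotopic := by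
  obtain ⟨-, -, H, hH0, hHZ⟩ := hZ
  let push : C(X, (Zᶜ : Set X)) := ⟨fun x => ⟨H (x, 1), hHZ x 1 one_pos⟩, by fun_prop⟩
  let incl : C((Zᶜ : Set X), X) := ⟨Subtype.val, continuous_subtype_val⟩
  have hpush : (ContinuousMap.id X).Homotopic (incl.comp push) := ⟨{
    toFun := fun q => H (q.2, q.1)
    continuous_toFun := by fun_prop
    map_zero_left := fun x => hH0 x
    map_one_left := fun x => rfl }⟩
  obtain ⟨x₀, hx₀⟩ := ((_root_.id_nullhomotopic (Zᶜ : Set X)).comp_left push).comp_right incl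
  exact ⟨x₀, hpush.trans hx₀⟩

-- Away from `X` the neighborhood retraction is slid along the contraction to its end point.
theorem IsANR.isAR {X : Type u} [TopologicalSpace X] (hX : IsANR X)
    (hnull : (ContinuousMap.id X).Nullhomotopic) : IsAR X := by
  classical
  intro Y _ _ _ e he
  obtain ⟨x₀, ⟨K⟩⟩ := hnull
  obtain ⟨O, hO, heO, r, hr⟩ := hX Y e he
  obtain ⟨O', hO', heO', hO'O⟩ := normal_exists_closure_subset he.isClosed_range hO heO
  obtain ⟨l, hl0, hl1, hl⟩ := exists_continuous_zero_one_of_isClosed he.isClosed_range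
    hO'.isClosed_compl (disjoint_compl_right_iff_subset.2 heO')
  let r' : Y → X := fun y => if h : y ∈ O then r ⟨y, h⟩ else x₀
  have hr'O : ∀ y : O, r' y = r y := fun y => dif_pos y.2
  have hr' : ContinuousOn r' O :=
    continuousOn_iff_continuous_domRestrict.2 (r.continuous.congr fun y => (hr'O y).symm)
  let R : Y → X := fun y => K (⟨l y, hl y⟩, r' y)
  have hR : Continuous R := by
    refine continuous_iff_continuousAt.2 fun y => ?_
    by_cases hy : y ∈ O
    · have hl' : Continuous fun y => (⟨l y, hl y⟩ : unitInterval) := by fun_prop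
      exact K.continuous.continuousAt.comp
        (hl'.continuousAt.prodMk (hr'.continuousAt (hO.mem_nhds hy)))
    · refine (continuousAt_const (y := x₀)).congr ?_
      filter_upwards [isClosed_closure.isOpen_compl.mem_nhds fun h => hy (hO'O h)] with z hz
      have hlz : (⟨l z, hl z⟩ : unitInterval) = 1 :=
        Subtype.ext (hl1 fun h => hz (subset_closure h))
      simp only [R, hlz, K.apply_one, ContinuousMap.const_apply]
  refine ⟨⟨R, hR⟩, fun x => ?_⟩
  have hlx : (⟨l (e x), hl (e x)⟩ : unitInterval) = 0 := Subtype.ext (hl0 ⟨x, rfl⟩)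
  have hrx : r' (e x) = x := (hr'O ⟨e x, heO ⟨x, rfl⟩⟩).trans (hr x _)
  simp only [ContinuousMap.coe_mk, R, hlx, K.apply_zero, ContinuousMap.id_apply, hrx]

theorem theoremB1 (n : ℕ) (X : Type u) [TopologicalSpace X] [CompactSpace X] [MetrizableSpace X]
    (hdim : CoveringDimLE n X) (Z : Set X) (hZc : IsClosed Z) (hZn : IsNowhereDense Z)
    (hLCC : IsLCC n Z) (hLC : IsLC n (Zᶜ : Set X)) :
    (IsANR X ∧ IsZSet Z) ∧ (ContractibleSpace (Zᶜ : Set X) → IsAR X) := by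
  have hANR : IsANR X := fun Y _ _ _ e he => by
    obtain ⟨O, hO, heO, r, hr, -⟩ := exists_neighborhood_retraction he hdim hZc hZn hLCC hLC
    exact ⟨O, hO, heO, r, hr⟩
  have hZ : IsZSet Z := isZSet_of_isLCC hdim hZc hZn hLCC hLC
  exact ⟨⟨hANR, hZ⟩, fun _ => hANR.isAR hZ.id_nullhomotopic⟩
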